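/- For integers $n, s \ge 1$, the $s$-sparse unique-disjointness problem $s$-$\mathrm{UDISJ}_n$ is the following two-party promise problem. Alice holds a set $A \subseteq \{1,\dots,n\}$ and Bob holds a set $B \subseteq \{1,\dots,n\}$ with $|A|, |B| \le s$; it is promised that either $A \cap B = \emptyset$ (no instance) or $|A \cap B| = 1$ (yes instance), and the parties have to decide which of the two is the case. Its deterministic communication complexity $D(s\text{-}\mathrm{UDISJ}_n)$ is the least worst-case number of bits exchanged by a deterministic two-party communication protocol that answers correctly on every input pair satisfying the promise. **Theorem.** Let $\varepsilon > 0$ be any constant. For all sparsities $s \le n^{1/2-\varepsilon}$, the deterministic communication complexity of $s$-sparse unique-disjointness is $\Omega(s \cdot \log(n/s))$. That is, for every $\varepsilon > 0$ there is a constant $c > 0$, depending only on $\varepsilon$, such that for all integers $n, s \ge 1$ with $s \le n^{1/2-\varepsilon}$, $$D(s\text{-}\mathrm{UDISJ}_n) \;\ge\; c \cdot s \cdot \log_2(n/s).$$ -/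

import Mathlib

/-- A two-party promise problem: Alice's inputs range over `X`, Bob's over `Y`; some input pairs
are `no` instances, some are `yes` instances, and the remaining pairs are excluded by the
promise. -/
structure PromiseProblem (X Y : Type) where
  no : Set (X × Y)
  yes : Set (X × Y)

/-- Deterministic two-party communication protocols, as binary trees. At an inner node one of the
parties sends one bit that depends on its own input and on the node (that is, on the
transcript so far); the play continues in the first subtree on the bit `false` and in the
second subtree on the bit `true`. A leaf is labelled with the output. -/
inductive Protocol (X Y : Type) : Type where
  | leaf (out : Bool) : Protocol X Y
  | alice (bit : X → Bool) (P₀ P₁ : Protocol X Y) : Protocol X Y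
  | bob (bit : Y → Bool) (P₀ P₁ : Protocol X Y) : Protocol X Y

namespace Protocol

variable {X Y : Type}

/-- The output of the protocol on the input pair `(x, y)`. -/
def eval : Protocol X Y → X → Y → Bool
  | leaf out, _, _ => out
  | alice bit P₀ P₁, x, y => if bit x then P₁.eval x y else P₀.eval x y
  | bob bit P₀ P₁, x, y => if bit y then P₁.eval x y else P₀.eval x y

/-- The cost of a protocol: the depth of its tree, i.e. the number of bits exchanged in the
worst case. -/
def cost : Protocol X Y → ℕ
  | leaf _ => 0
  | alice _ P₀ P₁ => max P₀.cost P₁.cost + 1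
  | bob _ P₀ P₁ => max P₀.cost P₁.cost + 1

/-- The protocol answers correctly on every input pair that satisfies the promise (nothing is
required on the other pairs). -/
def Solves (P : Protocol X Y) (F : PromiseProblem X Y) : Prop :=
  (∀ x y, (x, y) ∈ F.no → P.eval x y = false) ∧ (∀ x y, (x, y) ∈ F.yes → P.eval x y = true)

/-- On a finite set of inputs of Alice, every function is computed by some protocol. -/
theorem exists_eval_eq [Finite X] (g : X → Y → Bool) :
    ∃ P : Protocol X Y, ∀ x y, P.eval x y = g x y := by
  classical
  have := Fintype.ofFinite X
  have key : ∀ t : Finset X, ∃ P : Protocol X Y, ∀ x ∈ t, ∀ y, P.eval x y = g x y := by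
    intro t
    induction t using Finset.induction_on with
    | empty => exact ⟨leaf false, by simp⟩
    | insert a t _ ih =>
      obtain ⟨P, hP⟩ := ih
      refine ⟨alice (fun x => decide (x = a)) P (bob (g a) (leaf false) (leaf true)), ?_⟩
      intro x hx y
      by_cases hxa : x = a
      · subst hxa
        cases h : g x y <;> simp [eval, h]
      · have hxt : x ∈ t := (Finset.mem_insert.mp hx).resolve_left hxa
        simp [eval, hxa, hP x hxt y]
  obtain ⟨P, hP⟩ := key Finset.univ
  exact ⟨P, fun x y => hP x (Finset.mem_univ x) y⟩

end Protocol

/-- The deterministic communication complexity of a promise problem: the least cost of a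
deterministic protocol that solves it. -/
noncomputable def detCC {X Y : Type} (F : PromiseProblem X Y) : ℕ :=
  sInf {k : ℕ | ∃ P : Protocol X Y, P.Solves F ∧ P.cost = k}

/-- The minimum is attained if `X` is finite and no input pair is both a no and a yes
instance. -/
theorem detCC_spec {X Y : Type} [Finite X] (F : PromiseProblem X Y) (h : Disjoint F.no F.yes) :
    ∃ P : Protocol X Y, P.Solves F ∧ P.cost = detCC F := by
  classical
  obtain ⟨P, hP⟩ := Protocol.exists_eval_eq (fun (x : X) (y : Y) => decide ((x, y) ∈ F.yes))
  have hS : P.Solves F := by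
    refine ⟨fun x y hxy => ?_, fun x y hxy => ?_⟩
    · rw [hP]
      exact decide_eq_false (Set.disjoint_left.mp h hxy)
    · rw [hP]
      exact decide_eq_true hxy
  exact Nat.sInf_mem (s := {k : ℕ | ∃ P : Protocol X Y, P.Solves F ∧ P.cost = k}) ⟨_, P, hS, rfl⟩

/-- `s`-sparse unique-disjointness on the universe `Fin n`: Alice holds `A`, Bob holds `B`, both
of size at most `s`; either `A` and `B` are disjoint (no instances) or they have exactly one
common element (yes instances). -/
def sparseUDISJ (n s : ℕ) : PromiseProblem (Finset (Fin n)) (Finset (Fin n)) where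
  no := {p | p.1.card ≤ s ∧ p.2.card ≤ s ∧ Disjoint p.1 p.2}
  yes := {p | p.1.card ≤ s ∧ p.2.card ≤ s ∧ (p.1 ∩ p.2).card = 1}

/-- No input pair is both a no and a yes instance, so `detCC (sparseUDISJ n s)` is the cost of an
actual protocol. -/
theorem sparseUDISJ_disjoint (n s : ℕ) : Disjoint (sparseUDISJ n s).no (sparseUDISJ n s).yes := by
  rw [Set.disjoint_left]
  rintro ⟨A, B⟩ ⟨_, _, h₀⟩ ⟨_, _, h₁⟩
  simp only [Finset.disjoint_iff_inter_eq_empty] at h₀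
  simp [h₀] at h₁

/-! Cut the universe into `s` blocks of size `m = n / s` and let each party pick one element per
block: inputs become points of `[m]^s`, and the intersection size is the number of agreeing
coordinates. Follow a protocol towards a leaf, keeping a set `Z` of points and a set `I` of free
coordinates. On `I` both parties carry `z` itself; off `I`, no input of Alice agrees with any input
of Bob.

The invariant is an average of at least `d = 4sτ` points of `Z` on each line that meets `Z` in a
free direction, with `τ = log₂ s + O(1)`. A bit halves `Z`, but a constant fraction of the rest is
thick (`exists_isThick`). A direction whose average degree has become too small is given up at the
price of a factor `2d` (`exists_restore`); thickness makes this possible, since a random set splits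
most lines and so separates Alice's coordinate from Bob's (`exists_separating_set`). At a leaf, a
free coordinate would permit both answers (`not_decidesOn_leaf`), so `Z` has at most one point.

Hence `m^s ≤ 8^D (8sτ)^s` (`pow_le_of_detCC`). For large `n`, `s ≤ n^(1/2-ε)` forces `m ≥ n^ε ·
8sτ`, so `D ≥ (ε/3) s log₂ n`. -/

/-! ### Thick sets and separation by a random set -/

section Thick

open Finset

variable {ι α : Type} [DecidableEq ι] [DecidableEq α] [Fintype ι]

/-- Every line in a direction of `I` through a point of `Z` meets `Z` in at least `τ` points. -/
def IsThick [Fintype α] (Z : Finset (ι → α)) (I : Finset ι) (τ : ℕ) : Prop :=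
  ∀ z ∈ Z, ∀ i ∈ I, τ ≤ #{a | Function.update z i a ∈ Z}

/-- The lineShadow of `Z` in direction `i`: the coordinate `i` is overwritten by `o`. -/
def lineShadow (o : α) (i : ι) (Z : Finset (ι → α)) : Finset (ι → α) :=
  Z.image fun z => Function.update z i o

theorem shadow_mono (o : α) (i : ι) {Z Z' : Finset (ι → α)} (h : Z ⊆ Z') :
    lineShadow o i Z ⊆ lineShadow o i Z' := image_subset_image h

/-- A set of large average degree in all directions of `I` has a large thick subset. -/
theorem exists_isThick [Fintype α] (o : α) (Z : Finset (ι → α)) (I : Finset ι) (τ d : ℕ)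
    (hd : 2 * (#I * τ) ≤ d) (hdeg : ∀ i ∈ I, d * #(lineShadow o i Z) ≤ #Z) :
    ∃ Z' ⊆ Z, #Z ≤ 2 * #Z' ∧ IsThick Z' I τ := by
  -- The potential charges `τ` for each line met by the set. At `Z` it is at least `#Z / 2`, and
  -- deleting a line with fewer than `τ` points would increase it, so a maximizer is large and
  -- thick.
  obtain ⟨Z', hZ', hmax⟩ := exists_max_image Z.powerset
    (fun T => (#T : ℤ) - τ * ∑ i ∈ I, (#(lineShadow o i T) : ℤ)) ⟨Z, mem_powerset_self Z⟩
  rw [mem_powerset] at hZ'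
  refine ⟨Z', hZ', ?_, ?_⟩
  · have h1 := hmax Z (mem_powerset_self Z)
    have h2 : (0 : ℤ) ≤ τ * ∑ i ∈ I, (#(lineShadow o i Z') : ℤ) := by positivity
    have h3 : 2 * (τ * ∑ i ∈ I, #(lineShadow o i Z)) ≤ #Z := by
      rcases I.eq_empty_or_nonempty with rfl | hI
      · simp
      have h4 : #I * (2 * τ * ∑ i ∈ I, #(lineShadow o i Z)) ≤ #I * #Z := by
        calc #I * (2 * τ * ∑ i ∈ I, #(lineShadow o i Z))
            = ∑ i ∈ I, 2 * (#I * τ) * #(lineShadow o i Z) := by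
              rw [← mul_sum]; ring
          _ ≤ ∑ i ∈ I, #Z := sum_le_sum fun i hi =>
              (Nat.mul_le_mul_right _ hd).trans (hdeg i hi)
          _ = #I * #Z := by simp
      have := Nat.le_of_mul_le_mul_left h4 hI.card_pos
      linarith
    have h3' : 2 * ((τ : ℤ) * ∑ i ∈ I, (#(lineShadow o i Z) : ℤ)) ≤ #Z := by exact_mod_cast h3
    have h1' : (#Z : ℤ) - τ * ∑ i ∈ I, (#(lineShadow o i Z) : ℤ)
        ≤ #Z' - τ * ∑ i ∈ I, (#(lineShadow o i Z') : ℤ) := h1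
    have : (#Z : ℤ) ≤ 2 * #Z' := by linarith
    exact_mod_cast this
  · intro z hz i hi
    by_contra! hlt
    set F : Finset (ι → α) := ({a | Function.update z i a ∈ Z'} : Finset α).image
      (Function.update z i) with hF
    have hFZ : F ⊆ Z' := by
      intro y hy
      obtain ⟨a, ha, rfl⟩ := mem_image.1 hy
      exact (mem_filter.1 ha).2
    have hFc : #F < τ := card_image_le.trans_lt hlt
    have h1 := hmax (Z' \ F) (mem_powerset.2 (sdiff_subset.trans hZ'))
    have h1' : (#(Z' \ F) : ℤ) - τ * ∑ i ∈ I, (#(lineShadow o i (Z' \ F)) : ℤ)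
        ≤ #Z' - τ * ∑ i ∈ I, (#(lineShadow o i Z') : ℤ) := h1
    have h2 : #(Z' \ F) + #F = #Z' := card_sdiff_add_card_eq_card hFZ
    have h3 : ∑ j ∈ I, #(lineShadow o j (Z' \ F)) < ∑ j ∈ I, #(lineShadow o j Z') := by
      refine sum_lt_sum (fun j _ => card_le_card (shadow_mono o j sdiff_subset)) ⟨i, hi, ?_⟩
      refine card_lt_card ((ssubset_iff_of_subset (shadow_mono o i sdiff_subset)).2
        ⟨Function.update z i o, mem_image_of_mem _ hz, ?_⟩)
      intro hmem
      obtain ⟨y, hy, hyz⟩ := mem_image.1 hmem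
      rw [mem_sdiff] at hy
      have hy' : Function.update z i (y i) = y := by
        rw [← Function.update_idem (a := i) o (y i) z, ← hyz]; simp
      exact hy.2 (mem_image.2 ⟨y i, by simp [hy', hy.1], hy'⟩)
    have h3' : (∑ j ∈ I, (#(lineShadow o j (Z' \ F)) : ℤ)) + 1 ≤ ∑ j ∈ I, (#(lineShadow o j Z') : ℤ) := by
      exact_mod_cast h3
    have h2' : (#(Z' \ F) : ℤ) + #F = #Z' := by exact_mod_cast h2
    have hFc' : (#F : ℤ) < τ := by exact_mod_cast hFc
    have := mul_le_mul_of_nonneg_left h3' (Int.natCast_nonneg τ)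
    linarith

/-- Few sets miss a given large set. -/
theorem card_disjoint_le [Fintype α] (T : Finset α) (τ : ℕ) (hT : τ ≤ #T) :
    #{U : Finset α | Disjoint T U} * 2 ^ τ ≤ 2 ^ Fintype.card α := by
  have : ({U : Finset α | Disjoint T U} : Finset (Finset α)) = Tᶜ.powerset := by
    ext U
    simp [subset_compl_iff_disjoint_left]
  rw [this, card_powerset, card_compl, ← pow_add]
  exact Nat.pow_le_pow_right (by norm_num) (by have := card_le_univ T; omega)

/-- For two families of large sets, some set `U` meets most members of the first family and
leaves out an element of most members of the second one. -/
theorem exists_separating_set [Fintype α] {κ : Type} (W : Finset κ) (S T : κ → Finset α)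
    (τ : ℕ) (hS : ∀ w ∈ W, τ ≤ #(S w)) (hT : ∀ w ∈ W, τ ≤ #(T w)) :
    ∃ U : Finset α, #{w ∈ W | Disjoint (S w) U ∨ T w ⊆ U} * 2 ^ τ ≤ 2 * #W := by
  -- First moment: a uniformly random `U` is bad for a given `w` with probability at most `2 · 2 ^
  -- (-τ)`.
  by_contra! h
  have h1 : ∑ U : Finset α, #{w ∈ W | Disjoint (S w) U ∨ T w ⊆ U}
      = ∑ w ∈ W, #{U : Finset α | Disjoint (S w) U ∨ T w ⊆ U} := by
    simp only [card_filter]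
    exact sum_comm
  have h2 : ∀ w ∈ W, #{U : Finset α | Disjoint (S w) U ∨ T w ⊆ U} * 2 ^ τ
      ≤ 2 * 2 ^ Fintype.card α := by
    intro w hw
    have h3 := card_disjoint_le (S w) τ (hS w hw)
    have h4 := card_disjoint_le (T w) τ (hT w hw)
    have h5 : #{U : Finset α | T w ⊆ U} = #{U : Finset α | Disjoint (T w) U} := by
      refine card_bij (fun U _ => Uᶜ) ?_ ?_ ?_
      · intro U hU
        simpa [disjoint_compl_right_iff] using hU
      · intro U _ V _ hUV
        exact compl_injective hUV
      · intro U hU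
        refine ⟨Uᶜ, ?_, compl_compl U⟩
        simpa [subset_compl_iff_disjoint_right] using hU
    rw [filter_or]
    have h6 := card_union_le ({U : Finset α | Disjoint (S w) U} : Finset _)
      ({U : Finset α | T w ⊆ U} : Finset _)
    rw [h5] at h6
    have := Nat.mul_le_mul_right (2 ^ τ) h6
    linarith
  have h7 : ∑ _U : Finset α, 2 * #W
      < ∑ U : Finset α, #{w ∈ W | Disjoint (S w) U ∨ T w ⊆ U} * 2 ^ τ :=
    sum_lt_sum_of_nonempty univ_nonempty fun U _ => h U
  rw [← sum_mul univ (fun U => #{w ∈ W | Disjoint (S w) U ∨ T w ⊆ U}), h1, sum_mul] at h7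
  have h8 := sum_le_sum h2
  simp at h7 h8
  linarith

/-- In a thick set, most points of a family can be moved in the directions of `L` in two ways
which are separated from one another in each of these directions. -/
theorem exists_separated [Fintype α] {κ : Type} (Z : Finset (ι → α)) (L : Finset ι)
    (τ : ℕ) (hZ : IsThick Z L τ) (W : Finset κ) (g : κ → ι → α) (hg : ∀ w ∈ W, g w ∈ Z) :
    ∃ W' ⊆ W, ∃ u v : κ → ι → α, ∃ c : ι → Finset α,
      2 ^ τ * #W ≤ 2 ^ τ * #W' + 2 * #L * #W ∧
      (∀ w ∈ W', u w ∈ Z ∧ v w ∈ Z ∧ (∀ i ∉ L, u w i = g w i ∧ v w i = g w i) ∧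
        ∀ i ∈ L, u w i ∈ c i ∧ v w i ∉ c i) := by
  induction L using Finset.induction_on with
  | empty => exact ⟨W, Subset.rfl, g, g, fun _ => ∅, by simp, fun w hw => by simp [hg w hw]⟩
  | insert j L hj ih =>
    obtain ⟨W₁, hW₁, u, v, c, hcard, h⟩ := ih fun z hz i hi => hZ z hz i (mem_insert_of_mem hi)
    -- One `U` serves all `w`, so `u w` and `v w'` will differ in direction `j` for every pair `w`,
    -- `w'`, not only for `w = w'`.
    obtain ⟨U, hU⟩ := exists_separating_set W₁
      (fun w => ({a | Function.update (u w) j a ∈ Z} : Finset α))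
      (fun w => ({a | Function.update (v w) j a ∈ Z} : Finset α)) τ
      (fun w hw => hZ _ (h w hw).1 j (mem_insert_self j L))
      (fun w hw => hZ _ (h w hw).2.1 j (mem_insert_self j L))
    set B : κ → Prop := fun w => Disjoint ({a | Function.update (u w) j a ∈ Z} : Finset α) U ∨
      ({a | Function.update (v w) j a ∈ Z} : Finset α) ⊆ U with hB
    have hgood : ∀ w, ∃ p : α × α, ¬ B w → (Function.update (u w) j p.1 ∈ Z ∧ p.1 ∈ U) ∧
        (Function.update (v w) j p.2 ∈ Z ∧ p.2 ∉ U) := by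
      intro w
      by_cases hw : B w
      -- Arbitrary values: bad `w` are filtered out below.
      · exact ⟨(u w j, v w j), fun h => absurd hw h⟩
      simp only [hB, not_or, not_disjoint_iff, not_subset, mem_filter, mem_univ, true_and] at hw
      obtain ⟨⟨a, ha⟩, b, hb⟩ := hw
      exact ⟨(a, b), fun _ => ⟨ha, hb⟩⟩
    choose p hp using hgood
    refine ⟨W₁.filter (fun w => ¬ B w), (filter_subset _ _).trans hW₁,
      fun w => Function.update (u w) j (p w).1, fun w => Function.update (v w) j (p w).2,
      Function.update c j U, ?_, ?_⟩
    · have h1 : #(W₁.filter B) + #(W₁.filter fun w => ¬ B w) = #W₁ :=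
        card_filter_add_card_filter_not B
      have h2 : #W₁ ≤ #W := card_le_card hW₁
      rw [card_insert_of_notMem hj]
      have hU' : #(W₁.filter B) * 2 ^ τ ≤ 2 * #W₁ := hU
      rw [← h1] at hcard
      nlinarith
    · intro w hw
      obtain ⟨hw₁, hwB⟩ := mem_filter.1 hw
      obtain ⟨h1, h2, h3, h4⟩ := h w hw₁
      obtain ⟨⟨p1, p2⟩, p3, p4⟩ := hp w hwB
      refine ⟨p1, p3, fun i hi => ?_, fun i hi => ?_⟩
      · rw [mem_insert, not_or] at hi
        simp [Function.update_of_ne hi.1, h3 i hi.2]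
      · by_cases hij : i = j
        · subst hij; simp [p2, p4]
        · simp only [Function.update_of_ne hij]
          exact h4 i ((mem_insert.1 hi).resolve_left hij)

end Thick

/-! ### Following a protocol down to a leaf -/

section Simulation

open Finset

variable {ι α X Y : Type}

/-- The part of a rectangle that is still undecided: the coordinates in `I` are free and carry a
common point of `Z` on both sides; the other coordinates differ between the two sides. -/
structure IsFreeOn (o : α) (I : Finset ι) (Z : Finset (ι → α))
    (a b : (ι → α) → ι → α) : Prop where
  support : ∀ z ∈ Z, ∀ i ∉ I, z i = o
  left : ∀ z ∈ Z, ∀ i ∈ I, a z i = z i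
  right : ∀ z ∈ Z, ∀ i ∈ I, b z i = z i
  separated : ∀ z ∈ Z, ∀ z' ∈ Z, ∀ i ∉ I, a z i ≠ b z' i

theorem IsFreeOn.mono {o : α} {I : Finset ι} {Z Z' : Finset (ι → α)} {a b : (ι → α) → ι → α}
    (h : IsFreeOn o I Z a b) (hZ : Z' ⊆ Z) : IsFreeOn o I Z' a b :=
  ⟨fun z hz => h.support z (hZ hz), fun z hz => h.left z (hZ hz), fun z hz => h.right z (hZ hz),
    fun z hz z' hz' => h.separated z (hZ hz) z' (hZ hz')⟩

variable [DecidableEq ι] [DecidableEq α] [Fintype ι] [Fintype α]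

/-- The protocol `P` decides on the inputs encoded by `e (a z)`, `f (b z')`, for `z, z' ∈ Z`,
whether these have no or exactly one common coordinate. -/
def DecidesOn (P : Protocol X Y) (e : (ι → α) → X) (f : (ι → α) → Y) (Z : Finset (ι → α))
    (a b : (ι → α) → ι → α) : Prop :=
  ∀ z ∈ Z, ∀ z' ∈ Z, (#{i | a z i = b z' i} = 0 → P.eval (e (a z)) (f (b z')) = false) ∧
    (#{i | a z i = b z' i} = 1 → P.eval (e (a z)) (f (b z')) = true)

/-- With a free coordinate left, both answers are still possible. -/
theorem not_decidesOn_leaf {o : α} {I : Finset ι} {Z : Finset (ι → α)} {a b : (ι → α) → ι → α}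
    (hF : IsFreeOn o I Z a b) {τ : ℕ} (hτ : 4 * Fintype.card ι ≤ 2 ^ τ) (hT : IsThick Z I τ)
    (hZ : Z.Nonempty) (hI : I.Nonempty) (out : Bool) (e : (ι → α) → X) (f : (ι → α) → Y) :
    ¬ DecidesOn (Protocol.leaf out) e f Z a b := by
  intro hD
  obtain ⟨z, hz⟩ := hZ
  have key : ∀ L ⊆ I, ∃ u ∈ Z, ∃ v ∈ Z, (∀ i ∈ I, i ∉ L → u i = v i) ∧ ∀ i ∈ L, u i ≠ v i := by
    intro L hL
    obtain ⟨W', hW', u, v, c, hc, h⟩ := exists_separated Z L τ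
      (fun y hy i hi => hT y hy i (hL hi)) ({()} : Finset Unit) (fun _ => z) (by simpa using hz)
    have hW : W'.Nonempty := by
      rw [nonempty_iff_ne_empty]
      rintro rfl
      have := card_le_univ L
      have h2 : 0 < 2 ^ τ := by positivity
      simp at hc
      omega
    obtain ⟨w, hw⟩ := hW
    obtain ⟨h1, h2, h3, h4⟩ := h w hw
    exact ⟨u w, h1, v w, h2, fun i _ hi => (h3 i hi).1.trans (h3 i hi).2.symm,
      fun i hi he => (h4 i hi).2 (he ▸ (h4 i hi).1)⟩
  obtain ⟨j, hj⟩ := hI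
  -- Separating all free directions yields a no instance; sparing `j` yields a yes instance.
  obtain ⟨u, hu, v, hv, -, h2⟩ := key I Subset.rfl
  have hno := (hD u hu v hv).1 (by
    rw [card_eq_zero, filter_eq_empty_iff]
    intro i _
    by_cases hi : i ∈ I
    · rw [hF.left u hu i hi, hF.right v hv i hi]; exact h2 i hi
    · exact hF.separated u hu v hv i hi)
  obtain ⟨u, hu, v, hv, h1, h2⟩ := key (I.erase j) (erase_subset _ _)
  have hyes := (hD u hu v hv).2 (by
    rw [card_eq_one]
    refine ⟨j, ?_⟩
    ext i
    simp only [mem_filter, mem_univ, true_and, mem_singleton]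
    constructor
    · intro he
      by_contra hij
      by_cases hi : i ∈ I
      · rw [hF.left u hu i hi, hF.right v hv i hi] at he
        exact h2 i (mem_erase.2 ⟨hij, hi⟩) he
      · exact hF.separated u hu v hv i hi he
    · rintro rfl
      rw [hF.left u hu i hj, hF.right v hv i hj]
      exact h1 i hj (by simp))
  simp only [Protocol.eval] at hno hyes
  rw [hno] at hyes
  exact Bool.false_ne_true hyes

/-- Restoring large average degrees by giving up free coordinates. -/
theorem exists_restore {o : α} {I : Finset ι} {Z : Finset (ι → α)} {a b : (ι → α) → ι → α}
    (hF : IsFreeOn o I Z a b) {τ : ℕ} (hτ : 4 * Fintype.card ι ≤ 2 ^ τ) (hT : IsThick Z I τ)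
    (d : ℕ) :
    ∃ J ⊆ I, ∃ Z' : Finset (ι → α), ∃ u v : (ι → α) → ι → α,
      (∀ z ∈ Z', u z ∈ Z ∧ v z ∈ Z) ∧ IsFreeOn o J Z' (a ∘ u) (b ∘ v) ∧
      (∀ i ∈ J, d * #(lineShadow o i Z') ≤ #Z') ∧ #Z ≤ 2 * (2 * d) ^ #(I \ J) * #Z' := by
  set π : Finset ι → (ι → α) → ι → α := fun L z => L.piecewise (fun _ => o) z with hπ
  -- Give up a largest `L` whose projection shrinks `Z` by at most `2d` per coordinate. By
  -- maximality, every remaining direction has average degree above `2d` in the projection, hence at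
  -- least `d` in any half of it.
  obtain ⟨L, hL, hmax⟩ := exists_max_image
    (I.powerset.filter fun L => #Z ≤ (2 * d) ^ #L * #(Z.image (π L))) card
    ⟨∅, by simp [hπ]⟩
  rw [mem_filter, mem_powerset] at hL
  obtain ⟨hLI, hLc⟩ := hL
  set W := Z.image (π L) with hW
  have hpre : ∀ w ∈ W, ∃ z ∈ Z, π L z = w := fun w hw => mem_image.1 hw
  choose! g hgZ hg using hpre
  obtain ⟨W', hW', u, v, c, hc, h⟩ := exists_separated Z L τ
    (fun y hy i hi => hT y hy i (hLI hi)) W g hgZ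
  have hhalf : #W ≤ 2 * #W' := by
    have h1 := card_le_univ L
    have h2 : 0 < 2 ^ τ := by positivity
    have h3 : 2 * (2 * #L) * #W ≤ 2 ^ τ * #W := Nat.mul_le_mul_right _ (by omega)
    have h4 : 2 ^ τ * #W ≤ 2 ^ τ * (2 * #W') := by linarith
    exact Nat.le_of_mul_le_mul_left h4 h2
  have hoff : ∀ w ∈ W, ∀ i ∉ L, g w i = w i := by
    intro w hw i hi
    conv_rhs => rw [← hg w hw]
    simp [hπ, hi]
  refine ⟨I \ L, sdiff_subset, W', u, v, fun z hz => ⟨(h z hz).1, (h z hz).2.1⟩,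
    ⟨?_, ?_, ?_, ?_⟩, ?_, ?_⟩
  · intro w hw i hi
    rw [← hg w (hW' hw)]
    by_cases hiL : i ∈ L
    · simp [hπ, hiL]
    · have : i ∉ I := fun hiI => hi (mem_sdiff.2 ⟨hiI, hiL⟩)
      simp [hπ, hiL, hF.support _ (hgZ w (hW' hw)) i this]
  · intro w hw i hi
    rw [mem_sdiff] at hi
    obtain ⟨h1, -, h3, -⟩ := h w hw
    rw [Function.comp_apply, hF.left _ h1 i hi.1, (h3 i hi.2).1, hoff w (hW' hw) i hi.2]
  · intro w hw i hi
    rw [mem_sdiff] at hi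
    obtain ⟨-, h1, h3, -⟩ := h w hw
    rw [Function.comp_apply, hF.right _ h1 i hi.1, (h3 i hi.2).2, hoff w (hW' hw) i hi.2]
  · intro w hw w' hw' i hi
    obtain ⟨h1, -, -, h4⟩ := h w hw
    obtain ⟨-, h2', -, h4'⟩ := h w' hw'
    simp only [Function.comp_apply]
    by_cases hiI : i ∈ I
    · have hiL : i ∈ L := by
        by_contra hiL
        exact hi (mem_sdiff.2 ⟨hiI, hiL⟩)
      rw [hF.left _ h1 i hiI, hF.right _ h2' i hiI]
      intro he
      exact (h4' i hiL).2 (he ▸ (h4 i hiL).1)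
    · exact hF.separated _ h1 _ h2' i hiI
  · intro i hi
    rw [mem_sdiff] at hi
    have h1 : (2 * d) ^ (#L + 1) * #(lineShadow o i W) < #Z := by
      by_contra! hle
      have h2 : lineShadow o i W = Z.image (π (insert i L)) := by
        rw [lineShadow, hW, image_image]
        refine image_congr fun z _ => ?_
        simp [hπ, piecewise_insert]
      have := hmax (insert i L) (by
        rw [mem_filter, mem_powerset, card_insert_of_notMem hi.2, ← h2]
        exact ⟨insert_subset hi.1 hLI, hle⟩)
      rw [card_insert_of_notMem hi.2] at this
      omega
    have h3 : (2 * d) ^ #L * (2 * d * #(lineShadow o i W)) < (2 * d) ^ #L * #W := by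
      rw [← mul_assoc, ← pow_succ]
      exact h1.trans_le hLc
    have h4 := Nat.lt_of_mul_lt_mul_left h3
    have h5 := Nat.mul_le_mul_left (2 * d) (card_le_card (shadow_mono o i hW'))
    linarith
  · rw [Finset.sdiff_sdiff_eq_self hLI]
    calc #Z ≤ (2 * d) ^ #L * #W := hLc
      _ ≤ (2 * d) ^ #L * (2 * #W') := Nat.mul_le_mul_left _ hhalf
      _ = _ := by ring

/-- A Boolean function on `Z` is constant on at least half of `Z`. -/
theorem exists_half_of_bool {β : Type} [DecidableEq β] (Z : Finset β) (t : β → Bool) :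
    ∃ r : Bool, #Z ≤ 2 * #(Z.filter fun z => t z = r) := by
  by_contra! h
  have h1 := h true
  have h2 := h false
  have h3 := card_filter_add_card_filter_not (s := Z) (fun z => t z = true)
  simp only [Bool.not_eq_true] at h3
  omega

/-- Induction on the protocol. Each bit costs `8 = 2 · 2 · 2`: the majority answer, the thick subset
and the separated half in `exists_restore`. The factors `2d` paid there are absorbed by the drop of
`#I`. -/
theorem card_le_of_decidesOn (o : α) (e : (ι → α) → X) (f : (ι → α) → Y) (τ : ℕ)
    (hτ : 4 * Fintype.card ι ≤ 2 ^ τ) (d : ℕ) (hd : 4 * (Fintype.card ι * τ) ≤ d)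
    (P : Protocol X Y) (I : Finset ι) (Z : Finset (ι → α)) (a b : (ι → α) → ι → α)
    (hF : IsFreeOn o I Z a b) (hdeg : ∀ i ∈ I, d * #(lineShadow o i Z) ≤ #Z)
    (hD : DecidesOn P e f Z a b) : #Z ≤ 8 ^ P.cost * (2 * d) ^ #I := by
  have hIτ : ∀ I : Finset ι, 4 * (#I * τ) ≤ d := fun I =>
    (Nat.mul_le_mul_left 4 (Nat.mul_le_mul_right τ (card_le_univ I))).trans hd
  have step : ∀ (P Q : Protocol X Y) (I : Finset ι) (Z : Finset (ι → α))
      (a b : (ι → α) → ι → α) (t : (ι → α) → Bool),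
      (∀ I Z a b, IsFreeOn o I Z a b → (∀ i ∈ I, d * #(lineShadow o i Z) ≤ #Z) →
        DecidesOn P e f Z a b → #Z ≤ 8 ^ P.cost * (2 * d) ^ #I) →
      (∀ I Z a b, IsFreeOn o I Z a b → (∀ i ∈ I, d * #(lineShadow o i Z) ≤ #Z) →
        DecidesOn Q e f Z a b → #Z ≤ 8 ^ Q.cost * (2 * d) ^ #I) →
      IsFreeOn o I Z a b → (∀ i ∈ I, d * #(lineShadow o i Z) ≤ #Z) →
      DecidesOn P e f (Z.filter fun z => t z = false) a b →
      DecidesOn Q e f (Z.filter fun z => t z = true) a b →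
      #Z ≤ 8 ^ (max P.cost Q.cost + 1) * (2 * d) ^ #I := by
    intro P Q I Z a b t ihP ihQ hF hdeg hP hQ
    have main : ∀ (R : Protocol X Y) (r : Bool), R.cost ≤ max P.cost Q.cost →
        (∀ I Z a b, IsFreeOn o I Z a b → (∀ i ∈ I, d * #(lineShadow o i Z) ≤ #Z) →
          DecidesOn R e f Z a b → #Z ≤ 8 ^ R.cost * (2 * d) ^ #I) →
        DecidesOn R e f (Z.filter fun z => t z = r) a b →
        #Z ≤ 2 * #(Z.filter fun z => t z = r) →
        #Z ≤ 8 ^ (max P.cost Q.cost + 1) * (2 * d) ^ #I := by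
      intro R r hR ih hdec hhalf
      set Z₁ := Z.filter fun z => t z = r with hZ₁
      have hsub : Z₁ ⊆ Z := filter_subset _ _
      obtain ⟨Z₂, hZ₂, hc₂, hthick⟩ := exists_isThick o Z₁ I τ (2 * (#I * τ)) le_rfl (by
        -- The slack between `4 * (#I * τ) ≤ d` and the required `2 * (#I * τ)` absorbs the halving
        -- of `Z`.
        intro i hi
        have h1 := hdeg i hi
        have h2 := card_le_card (shadow_mono o i hsub)
        have h3 := Nat.mul_le_mul (hIτ I) h2
        linarith)
      obtain ⟨J, hJ, Z₃, u, v, huv, hF₃, hdeg₃, hc₃⟩ :=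
        exists_restore (hF.mono (hZ₂.trans hsub)) hτ hthick d
      have h3 := ih J Z₃ _ _ hF₃ hdeg₃ fun z hz z' hz' =>
        hdec (u z) (hZ₂ (huv z hz).1) (v z') (hZ₂ (huv z' hz').2)
      calc #Z ≤ 4 * #Z₂ := by linarith
        _ ≤ 4 * (2 * (2 * d) ^ #(I \ J) * #Z₃) := Nat.mul_le_mul_left _ hc₃
        _ ≤ 4 * (2 * (2 * d) ^ #(I \ J) * (8 ^ max P.cost Q.cost * (2 * d) ^ #J)) := by
          refine Nat.mul_le_mul_left _ (Nat.mul_le_mul_left _ (h3.trans ?_))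
          exact Nat.mul_le_mul_right _ (Nat.pow_le_pow_right (by norm_num) hR)
        _ = 8 ^ (max P.cost Q.cost + 1) * ((2 * d) ^ (#(I \ J) + #J)) := by
          rw [pow_succ, pow_add]; ring
        _ = _ := by rw [card_sdiff_add_card_eq_card hJ]
    obtain ⟨r, hr⟩ := exists_half_of_bool Z t
    cases r
    · exact main P false (le_max_left _ _) ihP hP hr
    · exact main Q true (le_max_right _ _) ihQ hQ hr
  induction P generalizing I Z a b with
  | leaf out =>
    rcases Z.eq_empty_or_nonempty with rfl | hZ
    · simp
    obtain ⟨Z₂, hZ₂, hc₂, hthick⟩ := exists_isThick o Z I τ d (by have := hIτ I; omega) hdeg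
    rcases I.eq_empty_or_nonempty with rfl | hI
    · simp only [card_empty, pow_zero, mul_one, Protocol.cost]
      refine card_le_one.2 fun z hz z' hz' => funext fun i => ?_
      rw [hF.support z hz i (by simp), hF.support z' hz' i (by simp)]
    · have hne : Z₂.Nonempty := by
        rw [← card_pos] at hZ ⊢
        omega
      exact absurd (fun z hz z' hz' => hD z (hZ₂ hz) z' (hZ₂ hz'))
        (not_decidesOn_leaf (hF.mono hZ₂) hτ hthick hne hI out e f)
  | alice bit P Q ihP ihQ =>
    refine step P Q I Z a b (fun z => bit (e (a z))) ihP ihQ hF hdeg ?_ ?_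
    all_goals
      intro z hz z' hz'
      rw [mem_filter] at hz hz'
      have := hD z hz.1 z' hz'.1
      simpa [Protocol.eval, hz.2] using this
  | bob bit P Q ihP ihQ =>
    refine step P Q I Z a b (fun z => bit (f (b z))) ihP ihQ hF hdeg ?_ ?_
    all_goals
      intro z hz z' hz'
      rw [mem_filter] at hz hz'
      have := hD z hz.1 z' hz'.1
      simpa [Protocol.eval, hz'.2] using this

end Simulation

/-! ### Block inputs and the bound for sparse unique-disjointness -/

section Bounds

open Finset

/-- The set that picks the element `x i` from the `i`-th of `s` blocks of size `m`. -/
def blockSet {n s m : ℕ} (φ : Fin s × Fin m ↪ Fin n) (x : Fin s → Fin m) : Finset (Fin n) :=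
  univ.image fun i => φ (i, x i)

theorem card_blockSet_le {n s m : ℕ} (φ : Fin s × Fin m ↪ Fin n) (x : Fin s → Fin m) :
    #(blockSet φ x) ≤ s := by
  simpa [blockSet] using card_image_le (s := (univ : Finset (Fin s))) (f := fun i => φ (i, x i))

theorem card_blockSet_inter {n s m : ℕ} (φ : Fin s × Fin m ↪ Fin n) (x y : Fin s → Fin m) :
    #(blockSet φ x ∩ blockSet φ y) = #{i | x i = y i} := by
  have : blockSet φ x ∩ blockSet φ y
      = ({i | x i = y i} : Finset (Fin s)).image fun i => φ (i, x i) := by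
    ext k
    simp only [blockSet, mem_inter, mem_image, mem_univ, true_and, mem_filter]
    constructor
    · rintro ⟨⟨i, rfl⟩, j, hj⟩
      have := φ.injective hj
      simp only [Prod.mk.injEq] at this
      obtain ⟨rfl, h⟩ := this
      exact ⟨j, h.symm, rfl⟩
    · rintro ⟨i, hi, rfl⟩
      exact ⟨⟨i, rfl⟩, i, by rw [hi]⟩
  rw [this, card_image_of_injective]
  intro i j hij
  simpa using congrArg Prod.fst (φ.injective hij)

theorem pow_le_of_detCC {n s m τ : ℕ} (hs : 1 ≤ s) (hsm : s * m ≤ n) (hτ : 4 * s ≤ 2 ^ τ) :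
    m ^ s ≤ 8 ^ detCC (sparseUDISJ n s) * (8 * (s * τ)) ^ s := by
  have hτ0 : 0 < τ := by
    rcases Nat.eq_zero_or_pos τ with rfl | h
    · simp at hτ; omega
    · exact h
  have hsτ : 0 < s * τ := Nat.mul_pos hs hτ0
  -- Smaller blocks make the bound trivial; otherwise the full grid, of degree `m` in every
  -- direction, satisfies the invariant.
  rcases lt_or_ge m (4 * (s * τ)) with hm | hm
  · calc m ^ s ≤ (8 * (s * τ)) ^ s := Nat.pow_le_pow_left (by omega) s
      _ ≤ _ := Nat.le_mul_of_pos_left _ (by positivity)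
  obtain ⟨P, hP, hcost⟩ := detCC_spec _ (sparseUDISJ_disjoint n s)
  let φ : Fin s × Fin m ↪ Fin n :=
    (finProdFinEquiv.toEmbedding).trans (Fin.castLEEmb hsm)
  let o : Fin m := ⟨0, by omega⟩
  have key := card_le_of_decidesOn o (blockSet φ) (blockSet φ) τ (by simpa using hτ)
    (4 * (s * τ)) (by simp) P univ univ id id
    ⟨by simp, by simp, by simp, by simp⟩ ?_ ?_
  · rw [hcost] at key
    have h8 : 2 * (4 * (s * τ)) = 8 * (s * τ) := by ring
    simpa [h8] using key
  · intro i _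
    refine (Nat.mul_le_mul_right _ hm).trans ?_
    have h1 : #(univ ×ˢ lineShadow o i univ : Finset (Fin m × (Fin s → Fin m)))
        ≤ #(univ : Finset (Fin s → Fin m)) := by
      refine card_le_card_of_injOn (fun p => Function.update p.2 i p.1) (by simp) ?_
      rintro ⟨a, w⟩ hw ⟨a', w'⟩ hw' h
      simp only [coe_product, Set.mem_prod, mem_coe, lineShadow, mem_image, mem_univ, true_and]
        at hw hw'
      obtain ⟨z, rfl⟩ := hw
      obtain ⟨z', rfl⟩ := hw'
      simp only [Function.update_idem] at h
      have ha : a = a' := by simpa using congrFun h i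
      have hz := congrArg (fun y => Function.update y i o) h
      simp only [Function.update_idem] at hz
      rw [ha, hz]
    simpa [card_product] using h1
  · intro x _ y _
    have hc := card_blockSet_inter φ x y
    refine ⟨fun h => hP.1 _ _ ⟨card_blockSet_le φ _, card_blockSet_le φ _, ?_⟩,
      fun h => hP.2 _ _ ⟨card_blockSet_le φ _, card_blockSet_le φ _, ?_⟩⟩
    · simp only [id] at h ⊢
      rw [h, card_eq_zero] at hc
      exact disjoint_iff_inter_eq_empty.2 hc
    · simp only [id] at h ⊢
      exact hc.trans h

theorem one_le_detCC_sparseUDISJ {n s : ℕ} (hn : 1 ≤ n) (hs : 1 ≤ s) :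
    1 ≤ detCC (sparseUDISJ n s) := by
  obtain ⟨P, hP, hcost⟩ := detCC_spec _ (sparseUDISJ_disjoint n s)
  rw [← hcost]
  let a : Fin n := ⟨0, hn⟩
  have h0 := hP.1 ∅ ∅ (by simp [sparseUDISJ])
  have h1 := hP.2 {a} {a} (by simp [sparseUDISJ, hs])
  cases P with
  | leaf out => simp_all [Protocol.eval]
  | alice => simp [Protocol.cost]
  | bob => simp [Protocol.cost]

end Bounds

/-! ### Choice of parameters and asymptotics -/

section Asymptotics

open Filter

/-- The gain per coordinate beats the loss `16 s² τ ≤ 16 n ^ (1 - 2ε) (log₂ n + 4)`. -/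
theorem exists_loss_le (ε : ℝ) (hε : 0 < ε) :
    ∃ N : ℕ, ∀ n : ℕ, N ≤ n → 16 * (Real.logb 2 n + 4) * (n : ℝ) ^ (1 - 2 * ε) ≤
      (n : ℝ) ^ (1 - ε) := by
  have h1 : Tendsto (fun x : ℝ => Real.log x / x ^ ε) atTop (nhds 0) :=
    (isLittleO_log_rpow_atTop hε).tendsto_div_nhds_zero
  have h2 : Tendsto (fun x : ℝ => x ^ (-ε)) atTop (nhds 0) := tendsto_rpow_neg_atTop hε
  have h3 : Tendsto (fun x : ℝ => 16 / Real.log 2 * (Real.log x / x ^ ε) + 64 * x ^ (-ε))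
      atTop (nhds 0) := by
    simpa using (h1.const_mul (16 / Real.log 2)).add (h2.const_mul 64)
  have h4 := ((h3.eventually (gt_mem_nhds one_pos)).and (eventually_ge_atTop 1)).natCast_atTop
  obtain ⟨N, hN⟩ := eventually_atTop.1 h4
  refine ⟨N, fun n hn => ?_⟩
  obtain ⟨h5, h6⟩ := hN n hn
  have hn0 : (0 : ℝ) < n := by linarith
  have h7 : 16 * (Real.logb 2 n + 4) * (n : ℝ) ^ (1 - 2 * ε) =
      (16 / Real.log 2 * (Real.log n / (n : ℝ) ^ ε) + 64 * (n : ℝ) ^ (-ε)) *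
        (n : ℝ) ^ (1 - ε) := by
    have h8 : (1 - 2 * ε) = -ε + (1 - ε) := by ring
    rw [h8, Real.rpow_add hn0, Real.rpow_neg hn0.le, Real.logb]
    have := Real.rpow_pos_of_pos hn0 ε
    field_simp
    ring
  rw [h7]
  exact mul_le_of_le_one_left (by positivity) h5.le

end Asymptotics

/-- For large `n` the bound is `s · ε log₂ n` up to the factor `3`. -/
theorem mul_logb_le_detCC {ε : ℝ} {n s : ℕ} (hn : 1 ≤ n) (hs : 1 ≤ s)
    (hsn : (s : ℝ) ≤ (n : ℝ) ^ (1 / 2 - ε)) (hε : 0 < ε)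
    (hN : 16 * (Real.logb 2 n + 4) * (n : ℝ) ^ (1 - 2 * ε) ≤ (n : ℝ) ^ (1 - ε)) :
    s * (ε * Real.logb 2 n) ≤ 3 * (detCC (sparseUDISJ n s) : ℝ) := by
  have hn1 : (1 : ℝ) ≤ n := by exact_mod_cast hn
  have hn0 : (0 : ℝ) < n := by linarith
  have hs1 : (1 : ℝ) ≤ s := by exact_mod_cast hs
  have hs0 : (0 : ℝ) < s := by linarith
  have hsn' : s ≤ n := by
    have : (s : ℝ) ≤ (n : ℝ) ^ (1 : ℝ) :=
      hsn.trans (Real.rpow_le_rpow_of_exponent_le hn1 (by linarith))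
    rw [Real.rpow_one] at this
    exact_mod_cast this
  set τ := Nat.log 2 s + 3 with hτ
  have h4s : 4 * s ≤ 2 ^ τ := by
    have := Nat.lt_pow_succ_log_self (b := 2) (by norm_num) s
    rw [hτ, show Nat.log 2 s + 3 = (Nat.log 2 s).succ + 2 by rfl, pow_add]
    omega
  have key := pow_le_of_detCC hs (Nat.mul_div_le n s) h4s
  have hτle : (τ : ℝ) ≤ Real.logb 2 n + 4 := by
    have h1 : ((2 : ℝ) ^ (Nat.log 2 s)) ≤ n := by
      exact_mod_cast (Nat.pow_log_le_self 2 (by omega)).trans hsn'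
    have h2 : ((Nat.log 2 s : ℕ) : ℝ) ≤ Real.logb 2 n := by
      rw [Real.le_logb_iff_rpow_le (by norm_num) hn0]
      simpa using h1
    rw [hτ]
    push_cast
    linarith
  -- Rounding down loses at most a factor `2`, as `n / s ≥ 1`.
  have hm : (n : ℝ) ≤ 2 * s * (n / s : ℕ) := by
    have h1 := Nat.div_add_mod n s
    have h2 := Nat.mod_lt n hs
    have h3 : 1 ≤ n / s := (Nat.one_le_div_iff hs).2 hsn'
    have h4 : n ≤ 2 * s * (n / s) := by nlinarith
    exact_mod_cast h4
  have hτ0 : (0 : ℝ) < τ := by positivity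
  have hss : (s : ℝ) * s ≤ (n : ℝ) ^ (1 - 2 * ε) := by
    calc (s : ℝ) * s ≤ (n : ℝ) ^ (1 / 2 - ε) * (n : ℝ) ^ (1 / 2 - ε) := by gcongr
      _ = _ := by rw [← Real.rpow_add hn0]; congr 1; ring
  have hgain : (n : ℝ) ^ ε * (8 * (s * τ)) ≤ (n / s : ℕ) := by
    have h1 : 16 * (τ : ℝ) * (s * s) ≤ (n : ℝ) ^ (1 - ε) := by
      refine le_trans ?_ hN
      have : 0 ≤ Real.logb 2 (n : ℝ) + 4 := hτ0.le.trans hτle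
      gcongr
    have h2 : (n : ℝ) ^ ε * (n : ℝ) ^ (1 - ε) = n := by
      rw [← Real.rpow_add hn0]; simp
    have h3 : (n : ℝ) ^ ε * (16 * (τ : ℝ) * (s * s)) ≤ 2 * s * (n / s : ℕ) := by
      refine (mul_le_mul_of_nonneg_left h1 (by positivity)).trans ?_
      rwa [h2]
    have h4 : (2 * s : ℝ) * ((n : ℝ) ^ ε * (8 * (s * τ))) ≤ 2 * s * (n / s : ℕ) := by
      refine le_trans (le_of_eq ?_) h3
      ring
    exact le_of_mul_le_mul_left h4 (by positivity)
  have key' : (((n / s : ℕ) : ℝ)) ^ s ≤ 8 ^ detCC (sparseUDISJ n s) * (8 * (s * τ)) ^ s := by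
    exact_mod_cast key
  have hpow : ((n : ℝ) ^ ε) ^ s ≤ 8 ^ detCC (sparseUDISJ n s) := by
    have h1 := (pow_le_pow_left₀ (by positivity) hgain s).trans key'
    rw [mul_pow] at h1
    exact le_of_mul_le_mul_right h1 (by positivity)
  have hlog := Real.logb_le_logb_of_le (b := 2) (by norm_num) (by positivity) hpow
  rw [Real.logb_pow, Real.logb_pow, Real.logb_rpow_eq_mul_logb_of_pos hn0,
    show (8 : ℝ) = 2 ^ 3 by norm_num, Real.logb_pow, Real.logb_self_eq_one (by norm_num)] at hlog
  push_cast at hlog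
  linarith

theorem theorem3 (ε : ℝ) (hε : 0 < ε) :
    ∃ c : ℝ, 0 < c ∧ ∀ n s : ℕ, 1 ≤ n → 1 ≤ s → (s : ℝ) ≤ (n : ℝ) ^ (1 / 2 - ε) →
      c * ((s : ℝ) * Real.logb 2 ((n : ℝ) / (s : ℝ))) ≤ (detCC (sparseUDISJ n s) : ℝ) := by
  obtain ⟨N, hN⟩ := exists_loss_le ε hε
  -- The second term handles `n < N`, where `s * log₂ n ≤ N * N` and one bit is needed anyway.
  refine ⟨min (ε / 3) (1 / ((N : ℝ) * N + 1)), by positivity, fun n s hn hs hsn => ?_⟩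
  have hn1 : (1 : ℝ) ≤ n := by exact_mod_cast hn
  have hs1 : (1 : ℝ) ≤ s := by exact_mod_cast hs
  have hsn' : (s : ℝ) ≤ n := by
    simpa using hsn.trans (Real.rpow_le_rpow_of_exponent_le hn1 (by linarith : 1 / 2 - ε ≤ 1))
  have hlog : Real.logb 2 ((n : ℝ) / s) ≤ Real.logb 2 n :=
    Real.logb_le_logb_of_le (by norm_num) (by positivity) (div_le_self (by linarith) hs1)
  have hlog0 : 0 ≤ Real.logb 2 (n : ℝ) := Real.logb_nonneg (by norm_num) hn1
  have hle : (s : ℝ) * Real.logb 2 ((n : ℝ) / s) ≤ s * Real.logb 2 n := by gcongr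
  refine (mul_le_mul_of_nonneg_left hle (by positivity)).trans ?_
  rcases le_or_gt N n with hNn | hNn
  · have h1 := mul_logb_le_detCC hn hs hsn hε (hN n hNn)
    have h2 : min (ε / 3) (1 / ((N : ℝ) * N + 1)) * (s * Real.logb 2 n)
        ≤ ε / 3 * (s * Real.logb 2 n) := by
      gcongr
      exact min_le_left _ _
    linarith
  · have hNn' : (n : ℝ) ≤ N := by exact_mod_cast hNn.le
    have h1 : (1 : ℝ) ≤ detCC (sparseUDISJ n s) := by
      exact_mod_cast one_le_detCC_sparseUDISJ hn hs
    have h2 : Real.logb 2 (n : ℝ) ≤ n := by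
      rw [Real.logb_le_iff_le_rpow (by norm_num) (by linarith), Real.rpow_natCast]
      exact_mod_cast Nat.lt_two_pow_self.le
    have h3 : (s : ℝ) * Real.logb 2 n ≤ N * N + 1 := by
      have : (s : ℝ) * Real.logb 2 n ≤ N * N := by
        gcongr
        · exact_mod_cast hsn'.trans hNn'
        · exact h2.trans hNn'
      linarith
    calc min (ε / 3) (1 / ((N : ℝ) * N + 1)) * (s * Real.logb 2 n)
        ≤ 1 / ((N : ℝ) * N + 1) * (N * N + 1) := by
          gcongr
          exact min_le_right _ _
      _ = 1 := by field_simp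
      _ ≤ _ := h1
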